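/- Let $m\ge 2$ and let the alphabet be $\mathbb{Z}_m=\mathbb{Z}/m\mathbb{Z}$. Let $t_m=(t_m^{(i)})_{i\ge 0}$ be the generalized Thue–Morse sequence, $t_m^{(i)}=s_2(i) \bmod m$, where $s_2(i)$ is the sum of the binary digits of $i$. Let the Thue–Morse subshift $L_m\subseteq \mathbb{Z}_m^{\mathbb{N}}$ be the closure, in the product topology (discrete alphabet), of $\{\sigma^n(t_m) : n\ge 0\}$, where $\sigma$ is the shift (erasing the first letter). Let $\varphi_m$ be the substitution $\varphi_m(k)=k\,(k+1)$, $k\in\mathbb{Z}_m$, extended to finite and infinite words by concatenation, and let $\varphi_m^\infty(k)$ be the infinite word that has every $\varphi_m^n(k)$, $n\ge 0$, as a prefix. A finite word $v$ is a factor of $L_m$ if it occurs in some word of $L_m$; a factor $v$ is left special if $av$ is a factor of $L_m$ for at least two letters $a$. Let $SP_{L_m}$ be the set of infinite left special words of $L_m$, that is, of the infinite words all of whose prefixes are left special factors of $L_m$. For an infinite word $w$ let $Lext(w)=\{u\in L_m : u=aw \text{ for some } a\in\mathbb{Z}_m\}$. Then $$SP_{L_m}=\{\varphi_m^\infty(k)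 : k\in\mathbb{Z}_m\}.$$ Moreover, this set is exactly the set of infinite words $w\in\mathbb{Z}_m^{\mathbb{N}}$ with $\varphi_m(w)=w$, and it has exactly $m$ elements. Finally, $\#Lext(w)=m$ for every $w\in SP_{L_m}$. -/

import Mathlib

/-! Infinite words over `A` are functions `ℕ → A`; finite words are lists. -/

namespace SymbDyn

variable {A : Type*}

/-- The shift map: erase the first letter. -/
def shift (w : ℕ → A) : ℕ → A := fun i => w (i + 1)

/-- The infinite word `a w`. -/
def cons (a : A) (w : ℕ → A) : ℕ → A
  | 0 => a
  | i + 1 => w i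

/-- The prefix of length `n` of an infinite word. -/
def pre (w : ℕ → A) (n : ℕ) : List A := (List.range n).map w

/-- The finite words `v` with `w = u' v u''`: the prefixes of the shifted words `shift^i w`. -/
def factors (w : ℕ → A) : Set (List A) := {v | ∃ i n, v = pre (shift^[i] w) n}

/-- The factors of a set of infinite words. -/
def Fact (L : Set (ℕ → A)) : Set (List A) := ⋃ w ∈ L, factors w

/-- The subshift induced by an infinite word: the closure of its shift orbit in the product
topology, where the alphabet is discrete. -/
def inducedSubshift (w : ℕ → A) : Set (ℕ → A) :=
  letI : TopologicalSpace A := ⊥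
  closure {w' | ∃ n, w' = shift^[n] w}

/-- The left letter extensions in `Fact L` of a finite word. -/
def Lext (L : Set (ℕ → A)) (v : List A) : Set (List A) :=
  {u | u ∈ Fact L ∧ ∃ a, u = a :: v}

/-- A factor is left special if it has at least two distinct left letter extensions. -/
def IsLeftSpecial (L : Set (ℕ → A)) (v : List A) : Prop :=
  v ∈ Fact L ∧ 1 < (Lext L v).encard

/-- The infinite left special words of `L`: all their prefixes are left special factors. -/
def SP (L : Set (ℕ → A)) : Set (ℕ → A) := {w | ∀ n, IsLeftSpecial L (pre w n)}

/-- The left letter extensions in `L` of an infinite word. -/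
def LextInf (L : Set (ℕ → A)) (w : ℕ → A) : Set (ℕ → A) :=
  {u | u ∈ L ∧ ∃ a, u = cons a w}

/-- A substitution for which no letter has an empty image. -/
structure Substitution (A : Type*) where
  img : A → List A
  img_ne_nil : ∀ a, img a ≠ []

namespace Substitution

/-- The action on finite words, by concatenation of the images of the letters. -/
def onList (φ : Substitution A) (v : List A) : List A := v.flatMap φ.img

theorem length_le_onList (φ : Substitution A) (v : List A) :
    v.length ≤ (φ.onList v).length := by
  induction v with
  | nil => simp
  | cons a v ih =>
    have h := List.length_pos_iff.mpr (φ.img_ne_nil a)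
    simp only [onList, List.flatMap_cons, List.length_append, List.length_cons] at ih ⊢
    omega

/-- The action on infinite words. The image of a prefix of length `i + 1` has length at least
`i + 1` and is a prefix of the image of the infinite word. -/
def onSeq (φ : Substitution A) (w : ℕ → A) : ℕ → A := fun i =>
  (φ.onList (pre w (i + 1)))[i]'(by
    have h := φ.length_le_onList (pre w (i + 1))
    simp only [pre, List.length_map, List.length_range] at h
    exact h)

/-- `φ(x) = x v` with `v` not empty. -/
def ProlongableAt (φ : Substitution A) (x : A) : Prop := ∃ v, v ≠ [] ∧ φ.img x = x :: v

theorem lt_length_iterate (φ : Substitution A) {x : A} (h : φ.ProlongableAt x) (n : ℕ) :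
    n < (φ.onList^[n] [x]).length := by
  obtain ⟨v, hv, hx⟩ := h
  have key : ∀ n, ∃ u, φ.onList^[n] [x] = x :: u ∧ n ≤ u.length := by
    intro n
    induction n with
    | zero => exact ⟨[], rfl, le_refl _⟩
    | succ n ih =>
      obtain ⟨u, hu, hn⟩ := ih
      refine ⟨v ++ φ.onList u, ?_, ?_⟩
      · rw [Function.iterate_succ_apply', hu]
        simp [onList, hx]
      · have h1 := φ.length_le_onList u
        have h2 := List.length_pos_iff.mpr hv
        rw [List.length_append]
        omega
  obtain ⟨u, hu, hn⟩ := key n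
  rw [hu, List.length_cons]
  omega

/-- The infinite word `φ^∞(x)`, limit of the words `φ^n(x)`: each of these is a prefix of the next
one, and `φ^n(x)` has more than `n` letters, so its letter of index `n` is that of the limit. -/
def limitWord (φ : Substitution A) (x : A) (h : φ.ProlongableAt x) : ℕ → A := fun n =>
  (φ.onList^[n] [x])[n]'(φ.lt_length_iterate h n)

end Substitution

/-- The generalized Thue–Morse substitution `k ↦ k (k+1)` over `ℤ/mℤ`. -/
def tmSubst (m : ℕ) : Substitution (ZMod m) where
  img k := [k, k + 1]
  img_ne_nil _ := List.cons_ne_nil _ _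

theorem tmSubst_prolongableAt (m : ℕ) (k : ZMod m) : (tmSubst m).ProlongableAt k :=
  ⟨[k + 1], List.cons_ne_nil _ _, rfl⟩

/-- The infinite word `φ_m^∞(k)`. -/
def tmLimit (m : ℕ) (k : ZMod m) : ℕ → ZMod m :=
  (tmSubst m).limitWord k (tmSubst_prolongableAt m k)

/-- The generalized Thue–Morse sequence: the sum of the binary digits, modulo `m`. -/
def thueMorse (m : ℕ) : ℕ → ZMod m := fun i => ((Nat.digits 2 i).sum : ZMod m)

/-- The Thue–Morse subshift `L_m`. -/
def tmSubshift (m : ℕ) : Set (ℕ → ZMod m) := inducedSubshift (thueMorse m)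

end SymbDyn

/-! Write `t` for `thueMorse m`. Everything rests on `t (n + 1) - t n = 1 - v`, with `v` the 2-adic
valuation of `n + 1` (`thueMorse_succ`). A long factor thus reveals its position modulo `2 ^ K`
(`modEq_two_pow_of_thueMorse_eq`). If it follows two different letters, that position is a multiple
of `2 ^ K`: otherwise both occurrences have the same valuation, hence the same preceding letter.
From `2 ^ K * r` one reads `t r + t i` for `i < 2 ^ K`, so an infinite left special word is a
translate of `t`. Translates of `t` are both the words `tmLimit m k` and the fixed points of the
substitution. Conversely, every prefix of a translate occurs after every letter
(`exists_thueMorse_occurrence`), which gives left specialness and the `m` extensions. -/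

namespace SymbDyn

/-! ### Factors of an orbit closure -/

section Words

variable {A : Type*}

theorem iterate_shift_apply (w : ℕ → A) (n i : ℕ) : shift^[n] w i = w (n + i) := by
  induction n generalizing i with
  | zero => simp
  | succ n ih =>
    rw [Function.iterate_succ_apply', shift, ih]
    congr 1
    omega

@[simp] theorem length_pre (w : ℕ → A) (n : ℕ) : (pre w n).length = n := by simp [pre]

theorem pre_eq_pre_iff (w w' : ℕ → A) (n : ℕ) : pre w n = pre w' n ↔ ∀ i < n, w i = w' i := by
  simp [pre]

theorem pre_cons (a : A) (w : ℕ → A) (n : ℕ) : pre (cons a w) (n + 1) = a :: pre w n := by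
  simp [pre, List.range_succ_eq_map, cons, Function.comp_def]

theorem cons_injective_left (w : ℕ → A) : Function.Injective (fun a => cons a w) :=
  fun _ _ h => congrFun h 0

/-- The points of the orbit closure are the words whose prefixes occur in the given word. -/
theorem mem_inducedSubshift_iff (u w : ℕ → A) :
    w ∈ inducedSubshift u ↔ ∀ N, ∃ n, ∀ i < N, w i = u (n + i) := by
  let _ : TopologicalSpace A := ⊥
  have : DiscreteTopology A := ⟨rfl⟩
  change w ∈ closure {w' | ∃ n, w' = shift^[n] u} ↔ _
  rw [mem_closure_iff]
  constructor
  · intro h N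
    have hopen : IsOpen (Set.pi (Set.Iio N) (fun i => ({w i} : Set A))) :=
      isOpen_set_pi (Set.finite_Iio N) (fun _ _ => isOpen_discrete _)
    obtain ⟨x, hx, n, rfl⟩ := h _ hopen (fun i _ => rfl)
    refine ⟨n, fun i hi => ?_⟩
    rw [← iterate_shift_apply u]
    exact (hx i hi).symm
  · intro h o ho hw
    obtain ⟨I, v, hv, hsub⟩ := isOpen_pi_iff.mp ho w hw
    obtain ⟨n, hn⟩ := h (I.sup id + 1)
    refine ⟨shift^[n] u, hsub fun i hi => ?_, n, rfl⟩
    rw [iterate_shift_apply, ← hn i (Nat.lt_succ_of_le (Finset.le_sup (f := id) hi))]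
    exact (hv i hi).2

theorem pre_mem_Fact_iff (u w : ℕ → A) (n : ℕ) :
    pre w n ∈ Fact (inducedSubshift u) ↔ ∃ p, ∀ i < n, w i = u (p + i) := by
  simp only [Fact, Set.mem_iUnion]
  constructor
  · rintro ⟨x, hx, i, n', h⟩
    have hn : n = n' := by simpa using congrArg List.length h
    subst hn
    rw [pre_eq_pre_iff] at h
    obtain ⟨p, hp⟩ := (mem_inducedSubshift_iff u x).mp hx (i + n)
    refine ⟨p + i, fun j hj => ?_⟩
    rw [h j hj, iterate_shift_apply, hp _ (by omega), add_assoc]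
  · rintro ⟨p, hp⟩
    refine ⟨u, (mem_inducedSubshift_iff u u).mpr fun N => ⟨0, by simp⟩, p, n, ?_⟩
    rw [pre_eq_pre_iff]
    intro i hi
    rw [hp i hi, iterate_shift_apply]

theorem cons_pre_mem_Fact_iff (u w : ℕ → A) (a : A) (n : ℕ) :
    a :: pre w n ∈ Fact (inducedSubshift u) ↔
      ∃ p, u p = a ∧ ∀ i < n, w i = u (p + 1 + i) := by
  rw [← pre_cons, pre_mem_Fact_iff]
  refine exists_congr fun p => ⟨fun h => ⟨(h 0 (by omega)).symm, fun i hi => ?_⟩, ?_⟩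
  · rw [add_assoc, add_comm 1 i]
    exact h (i + 1) (by omega)
  · rintro ⟨h0, h⟩ (_ | i) hi
    · exact h0.symm
    · rw [add_comm i 1, ← add_assoc, ← h i (by omega), add_comm 1 i]
      rfl

end Words

/-! ### Digit sums, special words and the substitution -/

section ThueMorse

variable (m : ℕ)

theorem thueMorse_zero : thueMorse m 0 = 0 := by simp [thueMorse]

theorem thueMorse_two_mul (n : ℕ) : thueMorse m (2 * n) = thueMorse m n := by
  rcases Nat.eq_zero_or_pos n with rfl | h
  · rfl
  · have := Nat.digits_add_two_add_one 0 (2 * n - 1)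
    rw [show 2 * n - 1 + 1 = 2 * n by omega] at this
    simp [thueMorse, this]

theorem thueMorse_two_mul_add_one (n : ℕ) :
    thueMorse m (2 * n + 1) = thueMorse m n + 1 := by
  have := Nat.digits_add_two_add_one 0 (2 * n)
  have h2 : (2 * n + 1) / 2 = n := by omega
  have h3 : (2 * n + 1) % 2 = 1 := by omega
  simp only [thueMorse, this, zero_add, h2, h3, List.sum_cons]
  push_cast
  ring

/-- The binary digits of the two summands do not overlap, so no carry occurs. -/
theorem thueMorse_two_pow_mul_add (K r i : ℕ) (hi : i < 2 ^ K) :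
    thueMorse m (2 ^ K * r + i) = thueMorse m r + thueMorse m i := by
  induction K generalizing i with
  | zero =>
    obtain rfl : i = 0 := by simpa using hi
    simp [thueMorse_zero]
  | succ K ih =>
    have hi2 : i / 2 < 2 ^ K := by rw [pow_succ] at hi; omega
    rcases Nat.even_or_odd' i with ⟨c, rfl | rfl⟩
    · rw [show 2 ^ (K + 1) * r + 2 * c = 2 * (2 ^ K * r + c) by ring, thueMorse_two_mul,
        thueMorse_two_mul, ih c (by omega)]
    · rw [show 2 ^ (K + 1) * r + (2 * c + 1) = 2 * (2 ^ K * r + c) + 1 by ring,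
        thueMorse_two_mul_add_one, thueMorse_two_mul_add_one, ih c (by omega), add_assoc]

theorem thueMorse_two_pow_mul (K r : ℕ) : thueMorse m (2 ^ K * r) = thueMorse m r := by
  simpa [thueMorse_zero] using thueMorse_two_pow_mul_add m K r 0 (by positivity)

theorem thueMorse_two_pow_sub_one (j : ℕ) : thueMorse m (2 ^ j - 1) = j := by
  induction j with
  | zero => simp [thueMorse_zero]
  | succ j ih =>
    have := Nat.one_le_two_pow (n := j)
    rw [show 2 ^ (j + 1) - 1 = 2 * (2 ^ j - 1) + 1 by rw [pow_succ]; omega,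
      thueMorse_two_mul_add_one, ih]
    simp

/-- The difference of two consecutive letters, from the dyadic valuation of the position. -/
theorem thueMorse_succ (n j : ℕ) (h : 2 ^ j ∣ n + 1) (h' : ¬ 2 ^ (j + 1) ∣ n + 1) :
    thueMorse m (n + 1) + j = thueMorse m n + 1 := by
  obtain ⟨c, hc⟩ := h
  rcases Nat.even_or_odd' c with ⟨r, rfl | rfl⟩
  · exact absurd ⟨r, by rw [hc]; ring⟩ h'
  · have := Nat.one_le_two_pow (n := j)
    -- In binary, `n` is `r` followed by `0` and `j` ones; `n + 1` is `r` followed by `1` and `j`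
    -- zeros.
    have hn : n = 2 ^ j * (2 * r) + (2 ^ j - 1) := by
      rw [mul_add] at hc
      omega
    have h1 : thueMorse m n = thueMorse m r + j := by
      conv_lhs => rw [hn]
      rw [thueMorse_two_pow_mul_add m j _ _ (by omega), thueMorse_two_mul,
        thueMorse_two_pow_sub_one]
    rw [hc, thueMorse_two_pow_mul, thueMorse_two_mul_add_one, h1]
    ring

/-- Two occurrences of a long factor of the Thue–Morse word are congruent modulo `2 ^ K`. -/
theorem modEq_two_pow_of_thueMorse_eq (hm : 2 ≤ m) (K p q : ℕ)
    (h : ∀ i ≤ 2 ^ (K + 1), thueMorse m (p + i) = thueMorse m (q + i)) :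
    p ≡ q [MOD 2 ^ K] := by
  induction K with
  | zero => simpa using Nat.modEq_one
  | succ K ih =>
    have hpq := ih fun i hi => h i (hi.trans (Nat.pow_le_pow_right two_pos (by omega)))
    by_contra hne
    have hpos : 0 < 2 ^ (K + 2) := by positivity
    -- The window meets every class modulo `2 ^ (K + 2)`. Choosing `p + i + 1` of valuation exactly
    -- `K + 1` forces valuation exactly `K` at `q + i + 1`; equal letters would then give `1 = 0` in
    -- `ZMod m`.
    obtain ⟨i, hi, c, hc⟩ :
        ∃ i, i + 1 ≤ 2 ^ (K + 2) ∧ 2 ^ (K + 2) ∣ p + i + 1 + 2 ^ (K + 1) := by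
      have hlt := Nat.mod_lt (p + 2 ^ (K + 1)) hpos
      have hdm := Nat.div_add_mod (p + 2 ^ (K + 1)) (2 ^ (K + 2))
      refine ⟨2 ^ (K + 2) - (p + 2 ^ (K + 1)) % 2 ^ (K + 2) - 1, by omega,
        (p + 2 ^ (K + 1)) / 2 ^ (K + 2) + 1, ?_⟩
      rw [mul_add, mul_one]
      omega
    have hp1 : 2 ^ (K + 1) ∣ p + i + 1 := by
      rw [← Nat.dvd_add_left (dvd_refl (2 ^ (K + 1)))]
      exact (pow_dvd_pow 2 (by omega)).trans ⟨c, hc⟩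
    have hp2 : ¬ 2 ^ (K + 1 + 1) ∣ p + i + 1 := by
      intro hd
      have h2 : 2 ^ (K + 2) ∣ 2 ^ (K + 1) := (Nat.dvd_add_right hd).mp ⟨c, hc⟩
      have := (Nat.pow_dvd_pow_iff_le_right (x := 2) (by omega)).mp h2
      omega
    have hq1 : 2 ^ K ∣ q + i + 1 :=
      (((hpq.add_right i).add_right 1).dvd_iff dvd_rfl).mp ((pow_dvd_pow 2 (by omega)).trans hp1)
    have hq2 : ¬ 2 ^ (K + 1) ∣ q + i + 1 := by
      intro hd
      refine hne (Nat.ModEq.add_right_cancel' (i + 1) ?_)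
      exact ((Nat.modEq_zero_iff_dvd).mpr hp1).trans ((Nat.modEq_zero_iff_dvd).mpr hd).symm
    have e1 := thueMorse_succ m _ _ hp1 hp2
    have e2 := thueMorse_succ m _ _ hq1 hq2
    have e3 := h (i + 1) hi
    have e4 := h i ((Nat.le_succ i).trans hi)
    rw [← add_assoc, ← add_assoc] at e3
    rw [e3, e4, ← e2] at e1
    have : _root_.Fact (1 < m) := ⟨hm⟩
    have e5 := add_left_cancel e1
    push_cast at e5
    exact one_ne_zero (left_eq_add.mp e5.symm)

/-- A long factor of the Thue–Morse word with two left extensions occurs at multiples of `2 ^ K`. -/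
theorem two_pow_dvd_of_thueMorse_ne (hm : 2 ≤ m) (K p q : ℕ)
    (hne : thueMorse m p ≠ thueMorse m q)
    (h : ∀ i ≤ 2 ^ (K + 1), thueMorse m (p + 1 + i) = thueMorse m (q + 1 + i)) :
    2 ^ K ∣ p + 1 := by
  have hpq := modEq_two_pow_of_thueMorse_eq m hm K _ _ h
  by_contra hK
  obtain ⟨j, r, hr, hj⟩ := Nat.exists_eq_two_pow_mul_odd (n := p + 1) (by omega)
  have hjK : j < K := by
    by_contra hjK
    exact hK ((pow_dvd_pow 2 (by omega)).trans ⟨r, hj⟩)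
  have hp1 : 2 ^ j ∣ p + 1 := ⟨r, hj⟩
  have hp2 : ¬ 2 ^ (j + 1) ∣ p + 1 := by
    rw [hj, pow_succ, Nat.mul_dvd_mul_iff_left (by positivity)]
    exact hr.not_two_dvd_nat
  have hq1 : 2 ^ j ∣ q + 1 := (hpq.dvd_iff (pow_dvd_pow 2 (by omega))).mp hp1
  have hq2 : ¬ 2 ^ (j + 1) ∣ q + 1 := (hpq.dvd_iff (pow_dvd_pow 2 (by omega))).not.mp hp2
  have e1 := thueMorse_succ m _ _ hp1 hp2
  have e2 := thueMorse_succ m _ _ hq1 hq2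
  have e3 := h 0 (by omega)
  rw [add_zero, add_zero] at e3
  rw [e3, e2] at e1
  exact hne (add_right_cancel e1).symm

/-- Every translate of a prefix of the Thue–Morse word occurs after every letter. -/
theorem exists_thueMorse_occurrence (hm : 2 ≤ m) (a k : ZMod m) (n : ℕ) :
    ∃ p, thueMorse m p = a ∧ ∀ i < n, k + thueMorse m i = thueMorse m (p + 1 + i) := by
  have : NeZero m := ⟨by omega⟩
  -- At `2 ^ E * (2 ^ f - 1)` the letter is `f`, preceded by `f + E - 1`. The residues of `f` and
  -- `E` make these `k` and `a`; the term `n * m` ensures `n ≤ E`, and the term `m` in `f` keeps `2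
  -- ^ f - 1` odd.
  set E := n * m + (1 - k + a).val
  set f := m + k.val
  have hE : (E : ZMod m) = 1 - k + a := by simp [E]
  have hf : (f : ZMod m) = k := by simp [f]
  have hnE : n ≤ E := (Nat.le_mul_of_pos_right n (by omega)).trans (Nat.le_add_right _ _)
  have h2f : 2 * 2 ^ (f - 1) = 2 ^ f := by rw [← pow_succ']; congr 1; omega
  have hf1 := Nat.one_le_two_pow (n := f - 1)
  have hodd : ¬ 2 ∣ 2 ^ f - 1 := by omega
  have hpos : 0 < 2 ^ E * (2 ^ f - 1) := Nat.mul_pos (by positivity) (by omega)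
  have hp : 2 ^ E * (2 ^ f - 1) - 1 + 1 = 2 ^ E * (2 ^ f - 1) := by omega
  refine ⟨2 ^ E * (2 ^ f - 1) - 1, ?_, fun i hi => ?_⟩
  · have e := thueMorse_succ m (2 ^ E * (2 ^ f - 1) - 1) E (by rw [hp]; exact dvd_mul_right _ _)
      (by rwa [hp, pow_succ, Nat.mul_dvd_mul_iff_left (by positivity)])
    rw [hp, thueMorse_two_pow_mul, thueMorse_two_pow_sub_one, hE, hf] at e
    linear_combination -e
  · rw [hp, thueMorse_two_pow_mul_add m E _ _ ((hi.trans_le hnE).trans Nat.lt_two_pow_self),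
      thueMorse_two_pow_sub_one, hf]

theorem tmSubst_onList_pre (w : ℕ → ZMod m) (n : ℕ) :
    (tmSubst m).onList (pre w n) = pre (fun i => w (i / 2) + (i % 2 : ℕ)) (2 * n) := by
  induction n with
  | zero => rfl
  | succ n ih =>
    have h1 : pre w (n + 1) = pre w n ++ [w n] := by simp [pre, List.range_succ]
    have h2 : (2 * n + 1) / 2 = n := by omega
    have h3 : (2 * n + 1) % 2 = 1 := by omega
    rw [h1, Substitution.onList, List.flatMap_append, ← Substitution.onList, ih,
      show 2 * (n + 1) = 2 * n + 1 + 1 by ring]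
    simp [pre, List.range_succ, tmSubst, h2, h3]

theorem tmSubst_onSeq_apply (w : ℕ → ZMod m) (i : ℕ) :
    (tmSubst m).onSeq w i = w (i / 2) + (i % 2 : ℕ) := by
  simp only [Substitution.onSeq, tmSubst_onList_pre]
  simp [pre]

theorem thueMorse_div_two_add_mod_two (i : ℕ) :
    thueMorse m (i / 2) + (i % 2 : ℕ) = thueMorse m i := by
  rcases Nat.even_or_odd' i with ⟨c, rfl | rfl⟩
  · simp [thueMorse_two_mul]
  · rw [thueMorse_two_mul_add_one, show (2 * c + 1) / 2 = c by omega,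
      show (2 * c + 1) % 2 = 1 by omega, Nat.cast_one]

/-- Being fixed means `w i = w (i / 2) + i % 2`, the recursion of the digit sum, so `w 0` determines
`w`. -/
theorem tmSubst_onSeq_eq_self_iff (w : ℕ → ZMod m) :
    (tmSubst m).onSeq w = w ↔ ∀ i, w i = w 0 + thueMorse m i := by
  constructor
  · intro h i
    induction i using Nat.strong_induction_on with
    | _ i ih =>
      rcases Nat.eq_zero_or_pos i with rfl | hi
      · simp [thueMorse_zero]
      · rw [← h, tmSubst_onSeq_apply, ih (i / 2) (by omega), add_assoc,
          thueMorse_div_two_add_mod_two, h]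
  · intro h
    funext i
    rw [tmSubst_onSeq_apply, h (i / 2), h i, add_assoc, thueMorse_div_two_add_mod_two]

theorem tmSubst_iterate_onList (k : ZMod m) (n : ℕ) :
    (tmSubst m).onList^[n] [k] = pre (fun i => k + thueMorse m i) (2 ^ n) := by
  induction n with
  | zero => simp [pre, thueMorse_zero]
  | succ n ih =>
    rw [Function.iterate_succ_apply', ih, tmSubst_onList_pre, pow_succ']
    simp only [add_assoc, thueMorse_div_two_add_mod_two]

theorem tmLimit_apply (k : ZMod m) (i : ℕ) : tmLimit m k i = k + thueMorse m i := by
  simp only [tmLimit, Substitution.limitWord, tmSubst_iterate_onList]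
  simp [pre]

theorem mem_range_tmLimit_iff (w : ℕ → ZMod m) :
    w ∈ Set.range (tmLimit m) ↔ ∀ i, w i = w 0 + thueMorse m i := by
  constructor
  · rintro ⟨k, rfl⟩ i
    simp [tmLimit_apply, thueMorse_zero]
  · intro h
    exact ⟨w 0, funext fun i => by rw [tmLimit_apply, h i]⟩

theorem tmLimit_injective : Function.Injective (tmLimit m) := fun k l h => by
  simpa [tmLimit_apply] using congrFun h 0

theorem encard_univ_zmod (hm : 2 ≤ m) : (Set.univ : Set (ZMod m)).encard = m := by
  have : NeZero m := ⟨by omega⟩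
  rw [Set.encard_univ, ENat.card_eq_coe_fintype_card, ZMod.card]

theorem cons_tmLimit_mem_tmSubshift (hm : 2 ≤ m) (a k : ZMod m) :
    cons a (tmLimit m k) ∈ tmSubshift m := by
  refine (mem_inducedSubshift_iff _ _).mpr fun N => ?_
  obtain ⟨p, hp, h⟩ := exists_thueMorse_occurrence m hm a k N
  refine ⟨p, ?_⟩
  rintro (_ | i) hi
  · exact hp.symm
  · rw [add_comm i 1, ← add_assoc, ← h i (by omega), ← tmLimit_apply, add_comm 1 i]
    rfl

theorem encard_LextInf_tmLimit (hm : 2 ≤ m) (k : ZMod m) :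
    (LextInf (tmSubshift m) (tmLimit m k)).encard = m := by
  have h : LextInf (tmSubshift m) (tmLimit m k) = (fun a => cons a (tmLimit m k)) '' Set.univ := by
    ext u
    constructor
    · rintro ⟨-, a, rfl⟩
      exact ⟨a, trivial, rfl⟩
    · rintro ⟨a, -, rfl⟩
      exact ⟨cons_tmLimit_mem_tmSubshift m hm a k, a, rfl⟩
  rw [h, (cons_injective_left _).encard_image, encard_univ_zmod m hm]

theorem tmLimit_mem_SP (hm : 2 ≤ m) (k : ZMod m) : tmLimit m k ∈ SP (tmSubshift m) := by
  have : _root_.Fact (1 < m) := ⟨hm⟩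
  intro n
  have key (a : ZMod m) : a :: pre (tmLimit m k) n ∈ Fact (tmSubshift m) := by
    refine (cons_pre_mem_Fact_iff _ _ _ _).mpr ?_
    simpa only [tmLimit_apply] using exists_thueMorse_occurrence m hm a k n
  constructor
  · obtain ⟨p, -, hp⟩ := (cons_pre_mem_Fact_iff _ _ _ _).mp (key 0)
    exact (pre_mem_Fact_iff _ _ _).mpr ⟨p + 1, hp⟩
  · rw [Set.one_lt_encard_iff]
    exact ⟨_, _, ⟨key 0, 0, rfl⟩, ⟨key 1, 1, rfl⟩, by simp⟩

theorem eq_add_thueMorse_of_mem_SP (hm : 2 ≤ m) (w : ℕ → ZMod m) (hw : w ∈ SP (tmSubshift m))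
    (n : ℕ) : w n = w 0 + thueMorse m n := by
  -- This length synchronizes modulo `2 ^ n`, and `n < 2 ^ n` puts index `n` inside the aligned
  -- block.
  obtain ⟨-, h⟩ := hw (2 ^ (n + 1) + 1)
  rw [Set.one_lt_encard_iff] at h
  obtain ⟨_, _, ⟨ha, a, rfl⟩, ⟨hb, b, rfl⟩, hab⟩ := h
  obtain ⟨p, rfl, hp⟩ := (cons_pre_mem_Fact_iff _ _ _ _).mp ha
  obtain ⟨q, rfl, hq⟩ := (cons_pre_mem_Fact_iff _ _ _ _).mp hb
  obtain ⟨r, hr⟩ := two_pow_dvd_of_thueMorse_ne m hm n p q (fun e => hab (by rw [e]))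
    (fun i hi => (hp i (by omega)).symm.trans (hq i (by omega)))
  have hn : n < 2 ^ n := Nat.lt_two_pow_self
  have hn' : 2 ^ n ≤ 2 ^ (n + 1) := Nat.pow_le_pow_right two_pos (by omega)
  rw [hp n (by omega), hp 0 (by omega), hr, thueMorse_two_pow_mul_add m n r n hn,
    thueMorse_two_pow_mul]

end ThueMorse

end SymbDyn

theorem mainTheorem3 (m : ℕ) (hm : 2 ≤ m) :
    SymbDyn.SP (SymbDyn.tmSubshift m) = Set.range (SymbDyn.tmLimit m) ∧
    Set.range (SymbDyn.tmLimit m) = {w : ℕ → ZMod m | (SymbDyn.tmSubst m).onSeq w = w} ∧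
    (Set.range (SymbDyn.tmLimit m)).encard = m ∧
    ∀ w ∈ SymbDyn.SP (SymbDyn.tmSubshift m),
      (SymbDyn.LextInf (SymbDyn.tmSubshift m) w).encard = m := by
  open SymbDyn in
  have hSP : SP (tmSubshift m) = Set.range (tmLimit m) := by
    refine Set.Subset.antisymm (fun w hw => ?_) ?_
    · exact (mem_range_tmLimit_iff m w).mpr (eq_add_thueMorse_of_mem_SP m hm w hw)
    · rintro _ ⟨k, rfl⟩
      exact tmLimit_mem_SP m hm k
  refine ⟨hSP, ?_, ?_, ?_⟩
  · ext w
    exact (SymbDyn.mem_range_tmLimit_iff m w).trans (SymbDyn.tmSubst_onSeq_eq_self_iff m w).symm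
  · rw [← Set.image_univ, (SymbDyn.tmLimit_injective m).encard_image,
      SymbDyn.encard_univ_zmod m hm]
  · rw [hSP]
    rintro _ ⟨k, rfl⟩
    exact SymbDyn.encard_LextInf_tmLimit m hm k
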